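/- For integers $n\ge 0$, $1\le s<p$ and reals $a,\sigma>0$, consider $Y=X\beta+\sigma\xi$, where $X\in\mathbb{R}^{n\times p}$ has i.i.d. standard Gaussian entries, $\xi\sim\mathcal N(0,\mathbb I_n)$ is independent of $X$, and $\beta\in\mathbb{R}^p$; let $\mathbf E_\beta$ denote expectation under the joint law of $(X,Y)$. Let $$\Omega^p_{s,a}=\{\beta\in\mathbb{R}^p:\ |\{i:\beta_i\neq 0\}|\le s,\ |\beta_i|\ge a \text{ whenever } \beta_i\ne 0\},\qquad \eta_\beta=(\mathbf 1\{\beta_1\ne0\},\dots,\mathbf 1\{\beta_p\neq 0\}).$$ A selector is a measurable function $\tilde\eta=\tilde\eta(X,Y)$ with values in $\{0,1\}^p$, and $|\tilde\eta-\eta_\beta|$ denotes the Hamming distance. Let $n=n(p)$, $s=s(p)$, $a=a(p)>0$, $\sigma=\sigma(p)>0$ depend on $p$, and let $\epsilon\in(0,1)$ be fixed. Suppose that for all sufficiently large $p$ we have $6\le s<p$, $a<\sqrt2\,\sigma$ and $$ n<(1-\epsilon)\,\frac{\log(p-s)+7\log s}{4\log\left(1+\frac{a^2}{4\sigma^2}\right)}.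 $$ Then there exists $c>0$ such that $$\liminf_{p\to\infty}\ \inf_{\tilde\eta}\ \sup_{\beta\in\Omega^p_{s,a}}\mathbf E_\beta|\tilde\eta-\eta_\beta|\ \ge\ c,$$ where $\inf_{\tilde\eta}$ is the infimum over all selectors (the liminf may be $+\infty$). In particular exact recovery under the Hamming risk fails: there is no sequence of selectors $\hat\eta=\hat\eta_p$ with $\lim_{p\to\infty}\sup_{\beta\in\Omega^p_{s,a}}\mathbf E_\beta|\hat\eta-\eta_\beta|=0$. -/

import Mathlib

open MeasureTheory ProbabilityTheory Filter Topology
open scoped ENNReal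

namespace SupportRecovery

/-- The set of `s`-sparse vectors of `ℝ^p` (at most `s` nonzero components) whose nonzero
components all have absolute value at least `a`. -/
def sparseSet (p s : ℕ) (a : ℝ) : Set (Fin p → ℝ) :=
  {β | hammingNorm β ≤ s ∧ ∀ i, β i ≠ 0 → a ≤ |β i|}

/-- The indicator vector of the support of `β`, as an element of `{0,1}^p`. -/
noncomputable def supportPattern {p : ℕ} (β : Fin p → ℝ) : Fin p → Bool :=
  fun i => decide (β i ≠ 0)

/-- The law of an `n × p` matrix with i.i.d. standard Gaussian entries. -/
noncomputable def gaussianDesign (n p : ℕ) : Measure (Fin n → Fin p → ℝ) :=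
  Measure.pi fun _ => Measure.pi fun _ => gaussianReal 0 1

/-- The standard Gaussian law on `ℝ^n`. -/
noncomputable def gaussianNoise (n : ℕ) : Measure (Fin n → ℝ) :=
  Measure.pi fun _ => gaussianReal 0 1

/-- The joint law of the observations `(X, Y)`, where `Y = X β + σ ξ`, `X` has i.i.d. standard
Gaussian entries and `ξ` is a standard Gaussian vector independent of `X`. -/
noncomputable def observationLaw (n p : ℕ) (σ : ℝ) (β : Fin p → ℝ) :
    Measure ((Fin n → Fin p → ℝ) × (Fin n → ℝ)) :=
  ((gaussianDesign n p).prod (gaussianNoise n)).map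
    fun z => (z.1, (Matrix.of z.1).mulVec β + σ • z.2)

/-- Selectors: measurable functions of the observations `(X, Y)` with values in `{0,1}^p`. -/
def Selector (n p : ℕ) : Type :=
  {η : (Fin n → Fin p → ℝ) × (Fin n → ℝ) → (Fin p → Bool) // Measurable η}

/-- The Hamming risk at `β` of a selector: the expected Hamming distance between the selector and
the indicator vector of the support of `β`. -/
noncomputable def hammingRisk {n p : ℕ} (σ : ℝ) (η : Selector n p) (β : Fin p → ℝ) : ℝ≥0∞ :=
  ∫⁻ z, (hammingDist (η.1 z) (supportPattern β) : ℝ≥0∞) ∂(observationLaw n p σ β)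

/-- The maximal Hamming risk of a selector over the class `sparseSet p s a`. -/
noncomputable def maxHammingRisk {n p : ℕ} (s : ℕ) (a σ : ℝ) (η : Selector n p) : ℝ≥0∞ :=
  ⨆ β ∈ sparseSet p s a, hammingRisk σ η β

/-- The minimax Hamming risk: the infimum over all selectors of the maximal Hamming risk. -/
noncomputable def minimaxHammingRisk (n p s : ℕ) (a σ : ℝ) : ℝ≥0∞ :=
  ⨅ η : Selector n p, maxHammingRisk s a σ η

end SupportRecovery

namespace SupportRecovery

/-! The minimax risk dominates the Bayes risk of detecting a single coordinate. For `β` equal to `a`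
on its support, adding `i` to a support `S` of size `m` translates the noise by `a / σ` times column
`i` of the design. The resulting log-likelihood ratio `Λ` has a law not depending on `S`. Counting
the pairs `(S, insert i S)` from either end shows that twice the maximal risk is at least `E min (p
- m, (m + 1) exp Λ)` (`le_two_mul_maxHammingRisk`).

Put `L = log (p - m)`, `l = log (m + 1)`, `v = (a / σ) ^ 2`. Then `E exp (t Λ) = (1 + t (1 - t) v) ^
(-n / 2)` (`mgf_logLikelihood`). Tilting by `exp (t Λ)` so that `Λ` concentrates near `L - l` bounds
the expectation below by about `exp ((1 - t) L + t l) * E exp (t Λ)` (`one_half_le_integral_min`).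
The sample size condition keeps this large for every `t` in `[1 / 2, 1]` (`half_mul_log_le`). -/

instance (n p : ℕ) : IsProbabilityMeasure (gaussianDesign n p) := by
  unfold gaussianDesign; infer_instance

instance (n : ℕ) : IsProbabilityMeasure (gaussianNoise n) := by
  unfold gaussianNoise; infer_instance

/-! ### Gaussian shifts and the moment generating function of the likelihood ratio. -/

lemma gaussianReal_eq_withDensity (v : ℝ) :
    gaussianReal v 1 =
      (gaussianReal 0 1).withDensity fun x => ENNReal.ofReal (Real.exp (v * x - v ^ 2 / 2)) := by
  rw [gaussianReal_of_var_ne_zero _ one_ne_zero, gaussianReal_of_var_ne_zero _ one_ne_zero,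
    ← withDensity_mul _ (measurable_gaussianPDF 0 1) (by fun_prop)]
  congr 1
  ext x
  simp only [gaussianPDF, gaussianPDFReal, Pi.mul_apply]
  rw [← ENNReal.ofReal_mul (by positivity), mul_assoc (√(2 * Real.pi * _))⁻¹, ← Real.exp_add]
  congr 3
  push_cast
  ring

lemma integrable_exp_shift (v : ℝ) :
    Integrable (fun x => Real.exp (v * x - v ^ 2 / 2)) (gaussianReal 0 1) := by
  simp_rw [sub_eq_add_neg, Real.exp_add]
  exact (integrable_exp_mul_gaussianReal v).mul_const _

lemma integral_exp_gaussianReal (v : ℝ) :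
    ∫ x, Real.exp (v * x) ∂(gaussianReal 0 1) = Real.exp (v ^ 2 / 2) := by
  have := congrFun (mgf_id_gaussianReal (μ := 0) (v := 1)) v
  simpa [mgf] using this

lemma map_add_gaussianNoise {n : ℕ} (v : Fin n → ℝ) :
    (gaussianNoise n).map (fun ξ => ξ + v) =
      (gaussianNoise n).withDensity fun ξ =>
        ENNReal.ofReal (∏ j, Real.exp (v j * ξ j - v j ^ 2 / 2)) := by
  have h1 : (gaussianNoise n).map (fun ξ => ξ + v) = Measure.pi fun j => gaussianReal (v j) 1 := by
    unfold gaussianNoise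
    have := Measure.pi_map_pi (μ := fun _ : Fin n => gaussianReal 0 1)
      (f := fun j (x : ℝ) => x + v j) (fun j => by fun_prop)
    rw [show (fun ξ : Fin n → ℝ => ξ + v) = fun ξ j => ξ j + v j from rfl, this]
    simp [gaussianReal_map_add_const]
  rw [h1]
  refine Measure.pi_eq fun s hs => ?_
  have hind : ∀ j, Integrable ((s j).indicator fun x => Real.exp (v j * x - v j ^ 2 / 2))
      (gaussianReal 0 1) := fun j => (integrable_exp_shift (v j)).indicator (hs j)
  have hnn : ∀ j x, 0 ≤ (s j).indicator (fun x => Real.exp (v j * x - v j ^ 2 / 2)) x :=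
    fun j x => Set.indicator_nonneg (fun _ _ => (Real.exp_pos _).le) x
  rw [withDensity_apply _ (MeasurableSet.univ_pi hs),
    ← lintegral_indicator (MeasurableSet.univ_pi hs)]
  have h2 : ((Set.univ.pi s).indicator fun ξ : Fin n → ℝ =>
      ENNReal.ofReal (∏ j, Real.exp (v j * ξ j - v j ^ 2 / 2))) = fun ξ =>
      ENNReal.ofReal (∏ j, (s j).indicator (fun x => Real.exp (v j * x - v j ^ 2 / 2)) (ξ j)) := by
    ext ξ
    by_cases h : ξ ∈ Set.univ.pi s
    · rw [Set.indicator_of_mem h]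
      congr 1
      exact Finset.prod_congr rfl fun j _ => by rw [Set.indicator_of_mem (h j trivial)]
    · rw [Set.indicator_of_notMem h]
      simp only [Set.mem_pi, Set.mem_univ, forall_const, not_forall] at h
      obtain ⟨j, hj⟩ := h
      rw [Finset.prod_eq_zero (Finset.mem_univ j) (Set.indicator_of_notMem hj _)]
      simp
  rw [h2, gaussianNoise, ← ofReal_integral_eq_lintegral_ofReal (Integrable.fintype_prod hind)
    (ae_of_all _ fun ξ => Finset.prod_nonneg fun j _ => hnn j _)]
  rw [integral_fintype_prod_eq_prod (𝕜 := ℝ)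
    (fun j => (s j).indicator fun x => Real.exp (v j * x - v j ^ 2 / 2)),
    ENNReal.ofReal_prod_of_nonneg fun j _ => integral_nonneg (hnn j)]
  refine Finset.prod_congr rfl fun j _ => ?_
  rw [gaussianReal_eq_withDensity (v j), withDensity_apply _ (hs j), ← lintegral_indicator (hs j),
    ofReal_integral_eq_lintegral_ofReal (hind j) (ae_of_all _ (hnn j))]
  congr 1
  ext x
  by_cases h : x ∈ s j <;> simp [h]

/-- The log-likelihood ratio between `ξ` shifted by `u` times the `i`-th column of the design
and `ξ` itself. -/
noncomputable def logLikelihood {n p : ℕ} (u : ℝ) (i : Fin p)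
    (z : (Fin n → Fin p → ℝ) × (Fin n → ℝ)) : ℝ :=
  ∑ j, (u * z.1 j i * z.2 j - (u * z.1 j i) ^ 2 / 2)

lemma measurable_logLikelihood {n p : ℕ} (u : ℝ) (i : Fin p) :
    Measurable (logLikelihood (n := n) u i) := by
  unfold logLikelihood; fun_prop

/-- Conditionally on the design the shift is deterministic, so the Gaussian translation formula
applies and Fubini finishes. -/
lemma lintegral_shift {n p : ℕ} (u : ℝ) (i : Fin p)
    {g : (Fin n → Fin p → ℝ) × (Fin n → ℝ) → ℝ≥0∞} (hg : Measurable g) :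
    ∫⁻ z, g (z.1, z.2 + fun j => u * z.1 j i) ∂((gaussianDesign n p).prod (gaussianNoise n)) =
      ∫⁻ z, ENNReal.ofReal (Real.exp (logLikelihood u i z)) * g z
        ∂((gaussianDesign n p).prod (gaussianNoise n)) := by
  have hm := measurable_logLikelihood (n := n) u i
  rw [lintegral_prod _ (by fun_prop), lintegral_prod _ (by fun_prop)]
  refine lintegral_congr fun X => ?_
  have h := map_add_gaussianNoise fun j => u * X j i
  have h1 : ∫⁻ ξ, g (X, ξ + fun j => u * X j i) ∂(gaussianNoise n) =
      ∫⁻ ξ, g (X, ξ) ∂((gaussianNoise n).map fun ξ => ξ + fun j => u * X j i) := by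
    rw [lintegral_map (by fun_prop) (by fun_prop)]
  rw [h1, h, lintegral_withDensity_eq_lintegral_mul _ (by fun_prop) (by fun_prop)]
  refine lintegral_congr fun ξ => ?_
  simp only [Pi.mul_apply, logLikelihood, Real.exp_sum]

lemma integral_exp_neg_sq_gaussianReal {c : ℝ} (hc : 0 < 1 + c) :
    Integrable (fun x => Real.exp (-(c / 2) * x ^ 2)) (gaussianReal 0 1) ∧
    ∫ x, Real.exp (-(c / 2) * x ^ 2) ∂(gaussianReal 0 1) = Real.exp (-(1 / 2) * Real.log (1 + c)) := by
  have hpdf : ∀ x, gaussianPDFReal 0 1 x * Real.exp (-(c / 2) * x ^ 2) =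
      (√(2 * Real.pi))⁻¹ * Real.exp (-((1 + c) / 2) * x ^ 2) := by
    intro x
    simp only [gaussianPDFReal]
    rw [mul_assoc, ← Real.exp_add]
    congr 2
    · norm_num
    · push_cast
      ring
  constructor
  · rw [gaussianReal_of_var_ne_zero _ one_ne_zero,
      integrable_withDensity_iff_integrable_smul' (measurable_gaussianPDF 0 1)
        (ae_of_all _ fun _ => gaussianPDF_lt_top)]
    simp only [toReal_gaussianPDF, smul_eq_mul, hpdf]
    exact (integrable_exp_neg_mul_sq (by linarith)).const_mul _
  · rw [integral_gaussianReal_eq_integral_smul one_ne_zero]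
    simp only [smul_eq_mul, hpdf]
    rw [integral_const_mul, integral_gaussian, ← Real.sqrt_inv, ← Real.sqrt_mul (by positivity),
      neg_mul, Real.exp_neg, one_div_mul_eq_div, Real.exp_half, Real.exp_log hc, ← Real.sqrt_inv]
    congr 1
    field_simp

/-- Integrating out the noise first leaves a Gaussian-type function of column `i` alone; its `n`
independent entries then each contribute a factor `(1 + t (1 - t) u ^ 2) ^ (-1 / 2)`. -/
lemma mgf_logLikelihood {n p : ℕ} (u t : ℝ) (i : Fin p) (h : 0 < 1 + t * (1 - t) * u ^ 2) :
    Integrable (fun z => Real.exp (t * logLikelihood u i z))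
      ((gaussianDesign n p).prod (gaussianNoise n)) ∧
    ∫ z, Real.exp (t * logLikelihood u i z) ∂((gaussianDesign n p).prod (gaussianNoise n)) =
      Real.exp (-(n / 2) * Real.log (1 + t * (1 - t) * u ^ 2)) := by
  have hm := measurable_logLikelihood (n := n) u i
  have hexp : ∀ (X : Fin n → Fin p → ℝ) (ξ : Fin n → ℝ),
      Real.exp (t * logLikelihood u i (X, ξ)) =
        ∏ j, (Real.exp (t * u * X j i * ξ j) * Real.exp (-(t * (u * X j i) ^ 2 / 2))) := by
    intro X ξ
    simp only [logLikelihood, Finset.mul_sum, Real.exp_sum, ← Real.exp_add]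
    refine Finset.prod_congr rfl fun j _ => ?_
    congr 1
    ring
  have hi1 : ∀ X : Fin n → Fin p → ℝ,
      Integrable (fun ξ => Real.exp (t * logLikelihood u i (X, ξ))) (gaussianNoise n) := by
    intro X
    simp only [hexp]
    exact Integrable.fintype_prod fun j =>
      (integrable_exp_mul_gaussianReal (t * u * X j i)).mul_const _
  have hi2 : ∀ X : Fin n → Fin p → ℝ,
      ∫ ξ, Real.exp (t * logLikelihood u i (X, ξ)) ∂(gaussianNoise n) =
        ∏ j, Real.exp (-(t * (1 - t) * u ^ 2 / 2) * (X j i) ^ 2) := by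
    intro X
    simp only [hexp]
    rw [gaussianNoise, integral_fintype_prod_eq_prod (𝕜 := ℝ)
      (fun j x => Real.exp (t * u * X j i * x) * Real.exp (-(t * (u * X j i) ^ 2 / 2)))]
    refine Finset.prod_congr rfl fun j _ => ?_
    rw [integral_mul_const, integral_exp_gaussianReal, ← Real.exp_add]
    congr 1
    ring
  obtain ⟨hj1, hj2⟩ := integral_exp_neg_sq_gaussianReal h
  have hk1 : Integrable (fun X : Fin n → Fin p → ℝ =>
      ∏ j, Real.exp (-(t * (1 - t) * u ^ 2 / 2) * (X j i) ^ 2)) (gaussianDesign n p) :=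
    Integrable.fintype_prod (f := fun _ (x : Fin p → ℝ) =>
      Real.exp (-(t * (1 - t) * u ^ 2 / 2) * (x i) ^ 2)) fun j =>
      integrable_comp_eval (i := i) (μ := fun _ : Fin p => gaussianReal 0 1) hj1
  have hint : Integrable (fun z => Real.exp (t * logLikelihood u i z))
      ((gaussianDesign n p).prod (gaussianNoise n)) := by
    rw [integrable_prod_iff (by fun_prop)]
    refine ⟨ae_of_all _ hi1, ?_⟩
    simp only [Real.norm_eq_abs, Real.abs_exp, hi2]
    exact hk1
  refine ⟨hint, ?_⟩
  rw [integral_prod _ hint]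
  simp only [hi2]
  rw [gaussianDesign, integral_fintype_prod_eq_prod (𝕜 := ℝ)
      (fun (_ : Fin n) (x : Fin p → ℝ) => Real.exp (-(t * (1 - t) * u ^ 2 / 2) * (x i) ^ 2))]
  rw [integral_comp_eval (i := i) (μ := fun _ : Fin p => gaussianReal 0 1)
    hj1.aestronglyMeasurable, hj2]
  simp only [Finset.prod_const, Finset.card_univ, Fintype.card_fin, ← Real.exp_nat_mul]
  congr 1
  ring

/-! ### Pointwise bounds and the exponent inequality. -/

/-- Within distance `r` of `L - l`, both arguments of the minimum dominate the tilted exponential.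
Outside that window one subtracted exponential exceeds `exp (t x)`, making the left side
nonpositive. All terms integrate to values of the moment generating function. -/
lemma tilted_le_min_exp {L l r h t x : ℝ} (hh : 0 ≤ h) (ht0 : 0 ≤ t) (ht1 : t ≤ 1) (hr : 0 ≤ r) :
    Real.exp (l + (1 - t) * (L - l) - r) * (Real.exp (t * x)
      - Real.exp (-(h * (L - l + r))) * Real.exp ((t + h) * x)
      - Real.exp (h * (L - l - r)) * Real.exp ((t - h) * x)) ≤
      min (Real.exp L) (Real.exp (l + x)) := by
  have hmin : 0 ≤ min (Real.exp L) (Real.exp (l + x)) := by positivity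
  have e1 := Real.exp_pos (-(h * (L - l + r)) + (t + h) * x)
  have e2 := Real.exp_pos (h * (L - l - r) + (t - h) * x)
  rw [← Real.exp_add, ← Real.exp_add]
  by_cases h1 : L - l + r < x
  · refine le_trans (mul_nonpos_of_nonneg_of_nonpos (Real.exp_pos _).le ?_) hmin
    have : Real.exp (t * x) ≤ Real.exp (-(h * (L - l + r)) + (t + h) * x) :=
      Real.exp_le_exp.2 (by nlinarith)
    linarith
  by_cases h2 : x < L - l - r
  · refine le_trans (mul_nonpos_of_nonneg_of_nonpos (Real.exp_pos _).le ?_) hmin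
    have : Real.exp (t * x) ≤ Real.exp (h * (L - l - r) + (t - h) * x) :=
      Real.exp_le_exp.2 (by nlinarith)
    linarith
  push Not at h1 h2
  calc _ ≤ Real.exp (l + (1 - t) * (L - l) - r) * Real.exp (t * x) := by gcongr; linarith
    _ = Real.exp (l + (1 - t) * (L - l) - r + t * x) := by rw [← Real.exp_add]
    _ ≤ _ := le_min (Real.exp_le_exp.2 (by nlinarith)) (Real.exp_le_exp.2 (by nlinarith))

/-- The case `t = 1` needs only the upper truncation: below `L - l` the minimum is `exp (l + x)`
itself. -/
lemma truncated_le_min_exp {L l h x : ℝ} (hh : 0 ≤ h) :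
    Real.exp l * (Real.exp (1 * x) - Real.exp (-(h * (L - l))) * Real.exp ((1 + h) * x)) ≤
      min (Real.exp L) (Real.exp (l + x)) := by
  have e1 := Real.exp_pos (-(h * (L - l)) + (1 + h) * x)
  rw [← Real.exp_add, one_mul]
  by_cases h1 : L - l < x
  · refine le_trans (mul_nonpos_of_nonneg_of_nonpos (Real.exp_pos _).le ?_)
      (show 0 ≤ min (Real.exp L) (Real.exp (l + x)) by positivity)
    have : Real.exp x ≤ Real.exp (-(h * (L - l)) + (1 + h) * x) :=
      Real.exp_le_exp.2 (by nlinarith)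
    linarith
  push Not at h1
  calc _ ≤ Real.exp l * Real.exp x := by gcongr; linarith
    _ = Real.exp (l + x) := by rw [← Real.exp_add]
    _ ≤ _ := le_min (Real.exp_le_exp.2 (by linarith)) le_rfl

lemma sub_two_mul_sq_le_log_one_add {y : ℝ} (hy : -(1 / 2) ≤ y) :
    y - 2 * y ^ 2 ≤ Real.log (1 + y) := by
  have h1 : 0 < 1 + y := by linarith
  refine le_trans ?_ (Real.one_sub_inv_le_log_of_pos h1)
  have h2 : 1 - (1 + y)⁻¹ = y / (1 + y) := by field_simp; ring
  rw [h2, le_div_iff₀ h1]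
  nlinarith [mul_nonneg (sq_nonneg y) (by linarith : (0 : ℝ) ≤ 1 + 2 * y)]

/-- Second-order expansion of the cumulant generating function of the log-likelihood ratio. -/
lemma log_quadratic_expansion {v t h : ℝ} (hv0 : 0 < v) (hv : v < 2) (ht0 : 1 / 2 ≤ t)
    (ht1 : t ≤ 1) (hh : |h| ≤ 1 / 10) :
    0 < 1 + (t + h) * (1 - (t + h)) * v ∧
    -(1 / 2) * Real.log (1 + (t + h) * (1 - (t + h)) * v) ≤
      -(1 / 2) * Real.log (1 + t * (1 - t) * v)
        + h * ((t - 1 / 2) * v / (1 + t * (1 - t) * v)) + 3 * v * h ^ 2 := by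
  set D := 1 + t * (1 - t) * v with hD
  have hD1 : 1 ≤ D := by
    have : 0 ≤ t * (1 - t) * v := by
      have := sub_nonneg.2 ht1
      positivity
    linarith
  have hD0 : 0 < D := by linarith
  set y := (h * (1 - 2 * t) * v - h ^ 2 * v) / D with hy
  have hfac : 1 + (t + h) * (1 - (t + h)) * v = D * (1 + y) := by
    rw [hy, mul_add, mul_div_cancel₀ _ hD0.ne', hD]; ring
  have hyabs : |y| ≤ 11 / 10 * |h| * v := by
    rw [hy, abs_div, abs_of_pos hD0]
    refine (div_le_self (abs_nonneg _) hD1).trans ?_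
    rw [← sub_mul, abs_mul, abs_of_pos hv0]
    refine mul_le_mul_of_nonneg_right ?_ hv0.le
    calc |h * (1 - 2 * t) - h ^ 2| ≤ |h * (1 - 2 * t)| + |h ^ 2| := abs_sub _ _
      _ = |h| * |1 - 2 * t| + |h| * |h| := by rw [abs_mul, sq, abs_mul]
      _ ≤ |h| * 1 + |h| * (1 / 10) := by
          gcongr
          rw [abs_le]; constructor <;> linarith
      _ = _ := by ring
  have hylow : -(1 / 2) ≤ y := by
    have := neg_abs_le y
    nlinarith [abs_nonneg h]
  have hy2 : y ^ 2 ≤ 121 / 50 * v * h ^ 2 := by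
    rw [← sq_abs y, ← sq_abs h]
    calc |y| ^ 2 ≤ (11 / 10 * |h| * v) ^ 2 := by gcongr
      _ = 121 / 100 * v * |h| ^ 2 * v := by ring
      _ ≤ 121 / 100 * v * |h| ^ 2 * 2 := by gcongr
      _ = _ := by ring
  have hlog := sub_two_mul_sq_le_log_one_add hylow
  rw [hfac, Real.log_mul hD0.ne' (by linarith)]
  refine ⟨mul_pos hD0 (by linarith), ?_⟩
  have hyeq : -(1 / 2) * y = h * ((t - 1 / 2) * v / D) + 1 / 2 * (h ^ 2 * v / D) := by
    rw [hy]; field_simp; ring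
  have hle : h ^ 2 * v / D ≤ h ^ 2 * v := div_le_self (by positivity) hD1
  nlinarith [mul_nonneg (sq_nonneg h) hv0.le]

/-- The cumulant generating function at `t` costs at most the fraction `1 - ε` of the
exponent `(1 - t) L + t l`. -/
lemma half_mul_log_le {n x L l t ε : ℝ} (hn0 : 0 ≤ n) (hε : ε < 1)
    (hx0 : 0 < x) (hx : x < 1 / 2) (hl0 : 0 ≤ l) (hlL : l ≤ L) (ht0 : 1 / 2 ≤ t) (ht1 : t ≤ 1)
    (hn : n * (4 * Real.log (1 + x)) ≤ (1 - ε) * (L + 7 * l)) :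
    n / 2 * Real.log (1 + t * (1 - t) * (4 * x)) ≤ (1 - ε) * ((1 - t) * L + t * l) := by
  have hq : x ≤ 5 / 4 * Real.log (1 + x) := by
    have h := Real.le_log_one_add_of_nonneg hx0.le
    have : 4 / 5 * x ≤ 2 * x / (x + 2) := by
      rw [le_div_iff₀ (by linarith)]; nlinarith
    linarith
  have h1t := sub_nonneg.2 ht1
  have hc0 : 0 ≤ t * (1 - t) * (4 * x) := by positivity
  have hA1 : Real.log (1 + t * (1 - t) * (4 * x)) ≤ Real.log (1 + x) := by
    refine Real.log_le_log (by linarith) ?_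
    nlinarith [mul_nonneg (sq_nonneg (2 * t - 1)) hx0.le]
  have hA2 : Real.log (1 + t * (1 - t) * (4 * x)) ≤ 5 * (1 - t) * Real.log (1 + x) := by
    have h := Real.log_le_sub_one_of_pos (show 0 < 1 + t * (1 - t) * (4 * x) by linarith)
    have : t * (1 - t) * (4 * x) ≤ (1 - t) * (4 * x) := by
      have := mul_le_mul_of_nonneg_right ht1 (mul_nonneg h1t (by linarith : 0 ≤ 4 * x))
      linarith
    nlinarith
  -- `g` is `min 1 (5 (1 - t))`. Since `(L + 7 l) / 8 = l + (L - l) / 8`, the bound `g ≤ 1` controls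
  -- the part in `l`, and `g ≤ 5 (1 - t)` the part in `L - l`.
  obtain ⟨g, hg0, hg1, hg2, hAg⟩ : ∃ g : ℝ, 0 ≤ g ∧ g ≤ 1 ∧ g ≤ 5 * (1 - t) ∧
      Real.log (1 + t * (1 - t) * (4 * x)) ≤ g * Real.log (1 + x) := by
    rcases le_total (1 : ℝ) (5 * (1 - t)) with h | h
    · exact ⟨1, by norm_num, le_rfl, h, by linarith⟩
    · exact ⟨5 * (1 - t), by positivity, h, le_rfl, hA2⟩
  calc n / 2 * Real.log (1 + t * (1 - t) * (4 * x)) ≤ n / 2 * (g * Real.log (1 + x)) := by gcongr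
    _ = g / 8 * (n * (4 * Real.log (1 + x))) := by ring
    _ ≤ g / 8 * ((1 - ε) * (L + 7 * l)) := by gcongr
    _ = (1 - ε) * (g * (L - l) / 8 + g * l) := by ring
    _ ≤ (1 - ε) * ((1 - t) * L + t * l) := by
        have hL := sub_nonneg.2 hlL
        have := sub_pos.2 hε
        refine mul_le_mul_of_nonneg_left ?_ this.le
        nlinarith [mul_le_mul_of_nonneg_right hg2 hL, mul_le_mul_of_nonneg_right hg1 hl0,
          mul_nonneg h1t hL]

/-! ### Lower bounds on the Bayes risk of the binary test. -/

lemma integrable_min_exp {Ω : Type*} [MeasurableSpace Ω] (μ : Measure Ω) [IsProbabilityMeasure μ]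
    {Λ : Ω → ℝ} (hΛ : Measurable Λ) (L l : ℝ) :
    Integrable (fun z => min (Real.exp L) (Real.exp (l + Λ z))) μ :=
  (integrable_const (Real.exp L)).mono' (by fun_prop) (ae_of_all _ fun z => by
    rw [Real.norm_of_nonneg (by positivity)]; exact min_le_left _ _)

/-- The moment generating function of `Λ` under `μ` is `(1 + t (1 - t) v) ^ (-n / 2)`. -/
def HasQuadraticMgf {Ω : Type*} [MeasurableSpace Ω] (μ : Measure Ω) (Λ : Ω → ℝ) (n v : ℝ) : Prop :=
  ∀ t : ℝ, 0 < 1 + t * (1 - t) * v → Integrable (fun z => Real.exp (t * Λ z)) μ ∧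
    ∫ z, Real.exp (t * Λ z) ∂μ = Real.exp (-(n / 2) * Real.log (1 + t * (1 - t) * v))

lemma exp_neg_one_le_half : Real.exp (-1) ≤ 1 / 2 := by
  have := Real.exp_neg_one_lt_d9
  linarith

lemma mul_le_of_mul_log_le {n v ε W : ℝ} (hn0 : 0 ≤ n) (hv0 : 0 < v) (hv : v < 2) (hε0 : 0 < ε)
    (hW : 0 ≤ W) (hn : n * (4 * Real.log (1 + v / 4)) ≤ (1 - ε) * W) :
    n * v ≤ 5 / 4 * W := by
  have hq : v ≤ 5 * Real.log (1 + v / 4) := by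
    have h := Real.le_log_one_add_of_nonneg (show 0 ≤ v / 4 by positivity)
    have : v / 5 ≤ 2 * (v / 4) / (v / 4 + 2) := by
      rw [le_div_iff₀ (by positivity)]; nlinarith
    linarith
  have := mul_le_mul_of_nonneg_left hq hn0
  nlinarith

section

variable {Ω : Type*} [MeasurableSpace Ω] {μ : Measure Ω} [IsProbabilityMeasure μ] {Λ : Ω → ℝ}
  {n v L l : ℝ}

/-- For such small `l`, the mean `n v / 2` of `Λ` under the alternative (the tilt `t = 1`) is well
below `L - l`. A Chernoff bound then shows that the alternative looks like the null with probability
at least `1 / 2`. -/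
lemma one_half_le_integral_min_of_small (hΛ : Measurable Λ) (hn0 : 0 ≤ n) (hv : v < 2)
    (hmgf : HasQuadraticMgf μ Λ n v) (hl0 : 0 ≤ l) (hL1 : 250 ≤ L) (hlL : l ≤ L / 50)
    (hnv : n * v ≤ 5 / 4 * (L + 7 * l)) (hv0 : 0 < v) :
    1 / 2 ≤ ∫ z, min (Real.exp L) (Real.exp (l + Λ z)) ∂μ := by
  have hD : 0 < 1 + (1 + 1 / 50) * (1 - (1 + 1 / 50)) * v := by norm_num; linarith
  obtain ⟨hi1, hM1⟩ := hmgf 1 (by norm_num)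
  obtain ⟨hi2, hM2⟩ := hmgf (1 + 1 / 50) hD
  have hle : ∫ z, Real.exp l * (Real.exp (1 * Λ z) - Real.exp (-(1 / 50 * (L - l))) *
      Real.exp ((1 + 1 / 50) * Λ z)) ∂μ ≤ ∫ z, min (Real.exp L) (Real.exp (l + Λ z)) ∂μ :=
    integral_mono ((hi1.sub (hi2.const_mul _)).const_mul _) (integrable_min_exp μ hΛ L l) fun z =>
      truncated_le_min_exp (by norm_num)
  refine le_trans ?_ hle
  rw [integral_const_mul, integral_sub hi1 (hi2.const_mul _), integral_const_mul, hM1, hM2,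
    ← Real.exp_add]
  have hlog := Real.one_sub_inv_le_log_of_pos hD
  have hinv : (1 + (1 + 1 / 50) * (1 - (1 + 1 / 50)) * v)⁻¹ ≤ 1 + 27 / 1250 * v := by
    rw [inv_le_iff_one_le_mul₀ hD]
    nlinarith
  have hexp : -(1 / 50 * (L - l)) + -(n / 2) *
      Real.log (1 + (1 + 1 / 50) * (1 - (1 + 1 / 50)) * v) ≤ -1 := by
    have h1 : -Real.log (1 + (1 + 1 / 50) * (1 - (1 + 1 / 50)) * v) ≤ 27 / 1250 * v := by
      linarith
    have h2 := mul_le_mul_of_nonneg_left h1 (by positivity : 0 ≤ n / 2)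
    linarith
  have he := (Real.exp_le_exp.2 hexp).trans exp_neg_one_le_half
  have hl1 : 1 ≤ Real.exp l := Real.one_le_exp hl0
  have h0 : Real.exp (-(n / 2) * Real.log (1 + 1 * (1 - 1) * v)) = 1 := by simp
  rw [h0]
  nlinarith

/-- If `L - l` is the mean of `Λ` under the exponential tilt at `t`, the integral is bounded below
up to the factor `exp (-r)` by the moment generating function at `t`. -/
lemma one_half_le_integral_min_of_tilt (hΛ : Measurable Λ) (hn0 : 0 ≤ n) (hv0 : 0 < v) (hv : v < 2)
    (hmgf : HasQuadraticMgf μ Λ n v) {t h r : ℝ} (ht0 : 1 / 2 ≤ t) (ht1 : t ≤ 1)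
    (hh0 : 0 ≤ h) (hh : h ≤ 1 / 10) (hr : 0 ≤ r)
    (hkt : n * ((t - 1 / 2) * v / (1 + t * (1 - t) * v)) = L - l)
    (hcurv : 3 * (n * v) * h ^ 2 - h * r ≤ -2)
    (hexp : 0 ≤ l + (1 - t) * (L - l) - r - n / 2 * Real.log (1 + t * (1 - t) * v)) :
    1 / 2 ≤ ∫ z, min (Real.exp L) (Real.exp (l + Λ z)) ∂μ := by
  have hhabs : |h| ≤ 1 / 10 := by rwa [abs_of_nonneg hh0]
  have hD : 0 < 1 + t * (1 - t) * v := by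
    have := sub_nonneg.2 ht1
    positivity
  obtain ⟨hDp, hp⟩ := log_quadratic_expansion hv0 hv ht0 ht1 hhabs
  obtain ⟨hDm, hm⟩ := log_quadratic_expansion (h := -h) hv0 hv ht0 ht1 (by rwa [abs_neg])
  rw [← sub_eq_add_neg] at hDm hm
  obtain ⟨hi, hM⟩ := hmgf t hD
  obtain ⟨hip, hMp⟩ := hmgf (t + h) hDp
  obtain ⟨him, hMm⟩ := hmgf (t - h) hDm
  have hsub : Integrable (fun z => Real.exp (t * Λ z)
      - Real.exp (-(h * (L - l + r))) * Real.exp ((t + h) * Λ z)) μ := hi.sub (hip.const_mul _)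
  have hle : ∫ z, Real.exp (l + (1 - t) * (L - l) - r) * (Real.exp (t * Λ z)
      - Real.exp (-(h * (L - l + r))) * Real.exp ((t + h) * Λ z)
      - Real.exp (h * (L - l - r)) * Real.exp ((t - h) * Λ z)) ∂μ ≤
      ∫ z, min (Real.exp L) (Real.exp (l + Λ z)) ∂μ :=
    integral_mono ((hsub.sub (him.const_mul _)).const_mul _)
      (integrable_min_exp μ hΛ L l) fun z => tilted_le_min_exp hh0 (by linarith) ht1 hr
  refine le_trans ?_ hle
  rw [integral_const_mul, integral_sub hsub (him.const_mul _),
    integral_sub hi (hip.const_mul _), integral_const_mul, integral_const_mul, hM, hMp, hMm,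
    ← Real.exp_add, ← Real.exp_add]
  generalize Real.log (1 + (t + h) * (1 - (t + h)) * v) = A at hp ⊢
  generalize Real.log (1 + (t - h) * (1 - (t - h)) * v) = B at hm ⊢
  generalize (t - 1 / 2) * v / (1 + t * (1 - t) * v) = k at hp hm hkt
  generalize Real.log (1 + t * (1 - t) * v) = K at hp hm hexp ⊢
  -- At the centring tilt the terms of first order in `h` cancel, leaving the curvature term minus
  -- `h * r`, which is at most `-2`.
  have hbp : -(h * (L - l + r)) + -(n / 2) * A ≤ -2 + -(n / 2) * K := by
    have := mul_le_mul_of_nonneg_left hp hn0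
    rw [← hkt]
    linarith
  have hbm : h * (L - l - r) + -(n / 2) * B ≤ -2 + -(n / 2) * K := by
    have := mul_le_mul_of_nonneg_left hm hn0
    rw [← hkt]
    linarith
  have hbp' := Real.exp_le_exp.2 hbp
  have hbm' := Real.exp_le_exp.2 hbm
  rw [Real.exp_add (-2)] at hbp' hbm'
  have he2 : Real.exp (-2) ≤ 1 / 4 := by
    rw [show (-2 : ℝ) = -1 + -1 by norm_num, Real.exp_add]
    have := mul_le_mul exp_neg_one_le_half exp_neg_one_le_half (Real.exp_pos _).le (by norm_num)
    linarith
  have he3 := mul_le_mul_of_nonneg_right he2 (Real.exp_pos (-(n / 2) * K)).le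
  calc (1 / 2 : ℝ) ≤ Real.exp (l + (1 - t) * (L - l) - r - n / 2 * K) * (1 / 2) := by
        have := Real.one_le_exp hexp
        linarith
    _ = Real.exp (l + (1 - t) * (L - l) - r) * (Real.exp (-(n / 2) * K) * (1 / 2)) := by
        rw [sub_eq_add_neg _ (n / 2 * K), Real.exp_add, neg_mul, mul_assoc]
    _ ≤ _ := mul_le_mul_of_nonneg_left (by linarith) (Real.exp_pos _).le

/-- A tilt centring the test; if it reaches `1`, the larger weight is lowered to `L'`. -/
lemma exists_tilt (hn0 : 0 ≤ n) (hv0 : 0 < v) (hlL : l ≤ L) :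
    ∃ t ∈ Set.Icc (1 / 2 : ℝ) 1, ∃ L' ≤ L,
      n * ((t - 1 / 2) * v / (1 + t * (1 - t) * v)) = L' - l ∧
        (1 - t) * (L' - l) = (1 - t) * (L - l) := by
  set k : ℝ → ℝ := fun t => n * ((t - 1 / 2) * v / (1 + t * (1 - t) * v)) with hk
  have hkc : ContinuousOn k (Set.Icc (1 / 2) 1) := by
    refine continuousOn_const.mul (ContinuousOn.div (by fun_prop) (by fun_prop) fun t ht => ?_)
    obtain ⟨h1, h2⟩ := ht
    have := sub_nonneg.2 h2
    positivity
  have hk0 : k (1 / 2) = 0 := by simp [hk]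
  obtain ⟨t, ht, hkt⟩ : ∃ t ∈ Set.Icc (1 / 2 : ℝ) 1, k t = min (L - l) (k 1) := by
    have h1 : 0 ≤ k 1 := by simp only [hk]; norm_num; positivity
    exact intermediate_value_Icc (by norm_num) hkc
      ⟨by rw [hk0]; exact le_min (sub_nonneg.2 hlL) h1, min_le_right _ _⟩
  rcases le_total (L - l) (k 1) with h | h
  · exact ⟨t, ht, L, le_rfl, by rw [← min_eq_left h, ← hkt], rfl⟩
  -- At `t = 1` the exponent no longer involves `L`, so lowering `L` costs nothing.
  · refine ⟨1, ⟨by norm_num, le_rfl⟩, l + k 1, by linarith, ?_, by simp⟩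
    rw [add_sub_cancel_left]

/-- A lower bound on the Bayes risk, with weights `exp L` and `exp l`, of a binary test with
log-likelihood ratio `Λ`. -/
lemma one_half_le_integral_min {ε : ℝ} (hΛ : Measurable Λ) (hn0 : 0 ≤ n)
    (hv0 : 0 < v) (hv : v < 2) (hmgf : HasQuadraticMgf μ Λ n v)
    (hε0 : 0 < ε) (hε : ε < 1) (hl0 : 0 ≤ l) (hlL : l ≤ L) (hL1 : 250 ≤ L)
    (hL2 : 2400000 ≤ ε ^ 2 * L)
    (hn : n * (4 * Real.log (1 + v / 4)) ≤ (1 - ε) * (L + 7 * l)) :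
    1 / 2 ≤ ∫ z, min (Real.exp L) (Real.exp (l + Λ z)) ∂μ := by
  have hL0 : 0 < L := by linarith
  have hnv := mul_le_of_mul_log_le hn0 hv0 hv hε0 (by linarith) hn
  by_cases hcase : l ≤ L / 50
  · exact one_half_le_integral_min_of_small hΛ hn0 hv hmgf hl0 hL1 hcase hnv hv0
  push Not at hcase
  obtain ⟨t, ⟨ht0, ht1⟩, L', hL'L, hkt, hLt⟩ := exists_tilt hn0 hv0 hlL
  -- The window `r` must fit in the slack `ε ((1 - t) L + t l)`, which is at least `ε L / 50`
  -- because `l > L / 50`. With `n v ≤ 10 L`, this `h` leaves `-ε ^ 2 L / 1200000 ≤ -2`.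
  refine (one_half_le_integral_min_of_tilt hΛ hn0 hv0 hv hmgf ht0 ht1
    (h := ε / 6000) (r := ε / 100 * L) (by positivity) (by linarith) (by positivity) hkt ?_ ?_).trans
    (integral_mono (integrable_min_exp μ hΛ L' l) (integrable_min_exp μ hΛ L l) fun z =>
      min_le_min_right _ (Real.exp_le_exp.2 hL'L))
  · have h1 : n * v ≤ 10 * L := by linarith
    have h2 : 3 * (n * v) * (ε / 6000) ^ 2 ≤ 3 * (10 * L) * (ε / 6000) ^ 2 := by gcongr
    have h3 : 3 * (10 * L) * (ε / 6000) ^ 2 - ε / 6000 * (ε / 100 * L) =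
        -(ε ^ 2 * L) / 1200000 := by ring
    linarith
  · have h1 := half_mul_log_le (x := v / 4) hn0 hε (by positivity) (by linarith) hl0 hlL ht0 ht1 hn
    rw [mul_div_cancel₀ _ (by norm_num : (4 : ℝ) ≠ 0)] at h1
    have h2 : l ≤ (1 - t) * L + t * l := by
      linarith [mul_nonneg (sub_nonneg.2 ht1) (sub_nonneg.2 hlL)]
    have h3 : ε / 100 * L ≤ ε * ((1 - t) * L + t * l) := by
      have := mul_le_mul_of_nonneg_left (show L / 100 ≤ (1 - t) * L + t * l by linarith) hε0.le
      linarith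
    rw [hLt]
    linarith

end

/-! ### Reduction of the Hamming risk to binary tests. -/

/-- The vector equal to `a` on `S` and to zero elsewhere. -/
noncomputable def constOn {p : ℕ} (a : ℝ) (S : Finset (Fin p)) : Fin p → ℝ :=
  fun k => if k ∈ S then a else 0

lemma supportPattern_constOn {p : ℕ} {a : ℝ} (ha : 0 < a) (S : Finset (Fin p)) (k : Fin p) :
    supportPattern (constOn a S) k = decide (k ∈ S) := by
  by_cases h : k ∈ S <;> simp [supportPattern, constOn, h, ha.ne']

lemma constOn_mem_sparseSet {p s : ℕ} {a : ℝ} (ha : 0 < a) {S : Finset (Fin p)}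
    (hS : S.card ≤ s) : constOn a S ∈ sparseSet p s a := by
  refine ⟨?_, fun i hi => ?_⟩
  · have : (Finset.univ.filter fun i => constOn a S i ≠ 0) = S := by
      ext i; simp [constOn, ha.ne']
    rw [hammingNorm, this]
    exact hS
  · by_cases h : i ∈ S
    · simp [constOn, h, le_abs_self]
    · simp [constOn, h] at hi

lemma measurableSet_selector {n p : ℕ} (η : Selector n p) (k : Fin p) (b : Bool) :
    MeasurableSet {z | η.1 z k = b} :=
  ((measurable_pi_apply k).comp η.2) (measurableSet_singleton b)

lemma hammingRisk_eq_sum {n p : ℕ} (σ : ℝ) (η : Selector n p) (β : Fin p → ℝ) :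
    hammingRisk σ η β =
      ∑ k, observationLaw n p σ β {z | η.1 z k = !supportPattern β k} := by
  have h : ∀ z, (hammingDist (η.1 z) (supportPattern β) : ℝ≥0∞) =
      ∑ k, {z | η.1 z k = !supportPattern β k}.indicator (fun _ => (1 : ℝ≥0∞)) z := by
    intro z
    rw [hammingDist, Finset.card_filter]
    push_cast
    refine Finset.sum_congr rfl fun k _ => ?_
    rw [Set.indicator_apply]
    congr 1
    rw [eq_iff_iff, Set.mem_ofPred_eq, Bool.eq_not]
  simp only [hammingRisk, h]
  rw [lintegral_finsetSum _ fun k _ =>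
    measurable_const.indicator (measurableSet_selector η k _)]
  exact Finset.sum_congr rfl fun k _ => lintegral_indicator_one (measurableSet_selector η k _)

lemma measurable_observation {n p : ℕ} (σ : ℝ) (β : Fin p → ℝ) :
    Measurable fun z : (Fin n → Fin p → ℝ) × (Fin n → ℝ) =>
      (z.1, (Matrix.of z.1).mulVec β + σ • z.2) := by
  refine measurable_fst.prodMk (measurable_pi_iff.2 fun j => ?_)
  simp only [Pi.add_apply, Matrix.mulVec, dotProduct, Matrix.of_apply, Pi.smul_apply, smul_eq_mul]
  fun_prop

/-- The weighted error of a test between the supports `S` and `insert i S` is at least the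
integral of the smaller of the two weighted likelihoods. -/
lemma lintegral_min_le_weighted_error {n p : ℕ} {a σ : ℝ} (hσ : 0 < σ) {S : Finset (Fin p)}
    {i : Fin p} (hi : i ∉ S) (η : Selector n p) (w₀ w₁ : ℝ≥0∞) :
    ∫⁻ z, min w₀ (w₁ * ENNReal.ofReal (Real.exp (logLikelihood (a / σ) i z)))
        ∂((gaussianDesign n p).prod (gaussianNoise n)) ≤
      w₀ * observationLaw n p σ (constOn a S) {z | η.1 z i = true} +
        w₁ * observationLaw n p σ (constOn a (insert i S)) {z | η.1 z i = false} := by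
  have hΛ := measurable_logLikelihood (n := n) (a / σ) i
  set F := fun z : (Fin n → Fin p → ℝ) × (Fin n → ℝ) =>
      (z.1, (Matrix.of z.1).mulVec (constOn a S) + σ • z.2) with hF
  have hFm : Measurable F := measurable_observation σ _
  have hA := fun b => hFm (measurableSet_selector η i b)
  have hshift : ∀ z : (Fin n → Fin p → ℝ) × (Fin n → ℝ),
      (z.1, (Matrix.of z.1).mulVec (constOn a (insert i S)) + σ • z.2) =
        F (z.1, z.2 + fun j => a / σ * z.1 j i) := by
    intro z
    have hc : constOn a (insert i S) = constOn a S + Pi.single i a := by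
      ext k
      by_cases hk : k = i
      · subst hk; simp [constOn, hi]
      · simp [constOn, hk]
    simp only [hF, hc, Matrix.mulVec_add, Matrix.mulVec_single]
    congr 1
    ext j
    simp only [Pi.add_apply, Pi.smul_apply, smul_eq_mul, Matrix.col_apply, Matrix.of_apply,
      MulOpposite.smul_eq_mul_unop, MulOpposite.unop_op]
    field_simp
    ring
  have h0 : observationLaw n p σ (constOn a S) {z | η.1 z i = true} =
      ∫⁻ z, (F ⁻¹' {z | η.1 z i = true}).indicator (fun _ => (1 : ℝ≥0∞)) z
        ∂((gaussianDesign n p).prod (gaussianNoise n)) := by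
    rw [observationLaw, Measure.map_apply hFm (measurableSet_selector η i _),
      ← lintegral_indicator_one (hA true)]
    rfl
  have h1 : observationLaw n p σ (constOn a (insert i S)) {z | η.1 z i = false} =
      ∫⁻ z, ENNReal.ofReal (Real.exp (logLikelihood (a / σ) i z)) *
        (F ⁻¹' {z | η.1 z i = false}).indicator (fun _ => (1 : ℝ≥0∞)) z
        ∂((gaussianDesign n p).prod (gaussianNoise n)) := by
    rw [← lintegral_shift (a / σ) i (measurable_const.indicator (hA false)), observationLaw,
      Measure.map_apply (measurable_observation σ _) (measurableSet_selector η i _),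
      ← lintegral_indicator_one (measurable_observation σ _ (measurableSet_selector η i _))]
    exact lintegral_congr fun z =>
      congrArg ({z | η.1 z i = false}.indicator fun _ => (1 : ℝ≥0∞)) (hshift z)
  have hm1 : Measurable ((F ⁻¹' {z | η.1 z i = true}).indicator (fun _ => (1 : ℝ≥0∞))) :=
    measurable_const.indicator (hA true)
  have hm2 : Measurable ((F ⁻¹' {z | η.1 z i = false}).indicator (fun _ => (1 : ℝ≥0∞))) :=
    measurable_const.indicator (hA false)
  rw [h0, h1, ← lintegral_const_mul _ hm1, ← lintegral_const_mul _ (by fun_prop),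
    ← lintegral_add_left (by fun_prop)]
  -- At each point exactly one of the two error indicators is `1`, so the sum is one of the two
  -- arguments of the minimum.
  refine lintegral_mono fun z => ?_
  cases hz : η.1 (F z) i
  · simp [hz]
  · simp [hz]

/-- Averaging over all pairs of nested supports of sizes `m` and `m + 1`. -/
lemma le_two_mul_maxHammingRisk {n p s m : ℕ} {a σ : ℝ} (ha : 0 < a) (hσ : 0 < σ) (hms : m + 1 ≤ s)
    (hmp : m < p) (η : Selector n p) {B : ℝ≥0∞}
    (hB : ∀ i : Fin p, B ≤ ∫⁻ z, min ((p - m : ℕ) : ℝ≥0∞)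
      (((m + 1 : ℕ) : ℝ≥0∞) * ENNReal.ofReal (Real.exp (logLikelihood (a / σ) i z)))
        ∂((gaussianDesign n p).prod (gaussianNoise n))) :
    B ≤ 2 * maxHammingRisk s a σ η := by
  classical
  set R := maxHammingRisk s a σ η with hR
  have hrisk : ∀ S : Finset (Fin p), S.card ≤ s → hammingRisk σ η (constOn a S) ≤ R := fun S hS =>
    le_iSup₂_of_le (constOn a S) (constOn_mem_sparseSet ha hS) le_rfl
  set P0 := fun (S : Finset (Fin p)) (i : Fin p) =>
    observationLaw n p σ (constOn a S) {z | η.1 z i = true} with hP0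
  set P1 := fun (S : Finset (Fin p)) (i : Fin p) =>
    observationLaw n p σ (constOn a S) {z | η.1 z i = false} with hP1
  have hr0 : ∀ S : Finset (Fin p), S.card ≤ s → ∑ i ∈ Sᶜ, P0 S i ≤ R := by
    intro S hS
    refine le_trans ?_ (hrisk S hS)
    rw [hammingRisk_eq_sum]
    refine le_trans (le_of_eq ?_) (Finset.sum_le_sum_of_subset (Finset.subset_univ Sᶜ))
    refine Finset.sum_congr rfl fun i hi => ?_
    simp [hP0, supportPattern_constOn ha, Finset.mem_compl.1 hi]
  have hr1 : ∀ S : Finset (Fin p), S.card ≤ s → ∑ i ∈ S, P1 S i ≤ R := by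
    intro S hS
    refine le_trans ?_ (hrisk S hS)
    rw [hammingRisk_eq_sum]
    refine le_trans (le_of_eq ?_) (Finset.sum_le_sum_of_subset (Finset.subset_univ S))
    refine Finset.sum_congr rfl fun i hi => ?_
    simp [hP1, supportPattern_constOn ha, hi]
  set 𝒮 := Finset.powersetCard m (Finset.univ : Finset (Fin p))
  set 𝒯 := Finset.powersetCard (m + 1) (Finset.univ : Finset (Fin p))
  -- Pairs `(S, i)` with `i ∉ S` correspond to pairs `(T, i)` with `i ∈ T` through `T = insert i S`.
  have hpair : ∑ S ∈ 𝒮, ∑ i ∈ Sᶜ, P1 (insert i S) i = ∑ T ∈ 𝒯, ∑ i ∈ T, P1 T i := by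
    rw [Finset.sum_sigma', Finset.sum_sigma']
    refine Finset.sum_bij' (fun x _ => ⟨insert x.2 x.1, x.2⟩) (fun x _ => ⟨x.1.erase x.2, x.2⟩)
      ?_ ?_ ?_ ?_ ?_
    · rintro ⟨S, i⟩ h
      simp only [Finset.mem_sigma, Finset.mem_powersetCard_univ, Finset.mem_compl, 𝒮, 𝒯] at h ⊢
      exact ⟨by rw [Finset.card_insert_of_notMem h.2, h.1], Finset.mem_insert_self _ _⟩
    · rintro ⟨T, i⟩ h
      simp only [Finset.mem_sigma, Finset.mem_powersetCard_univ, Finset.mem_compl, 𝒮, 𝒯] at h ⊢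
      exact ⟨by rw [Finset.card_erase_of_mem h.2, h.1]; rfl, Finset.notMem_erase _ _⟩
    · rintro ⟨S, i⟩ h
      simp only [Finset.mem_sigma, Finset.mem_compl] at h
      simp [Finset.erase_insert h.2]
    · rintro ⟨T, i⟩ h
      simp only [Finset.mem_sigma] at h
      simp [Finset.insert_erase h.2]
    · rintro ⟨S, i⟩ _
      rfl
  have hcard𝒮 : 𝒮.card = p.choose m := by simp [𝒮]
  have hcard𝒯 : 𝒯.card = p.choose (m + 1) := by simp [𝒯]
  set N : ℕ := p.choose m * (p - m) with hN
  have hN' : N = p.choose (m + 1) * (m + 1) := (Nat.choose_succ_right_eq p m).symm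
  have hNpos : 0 < N := Nat.mul_pos (Nat.choose_pos hmp.le) (by omega)
  have hlow : (N : ℝ≥0∞) * B ≤ ∑ S ∈ 𝒮, ∑ i ∈ Sᶜ,
      (((p - m : ℕ) : ℝ≥0∞) * P0 S i + ((m + 1 : ℕ) : ℝ≥0∞) * P1 (insert i S) i) := by
    calc (N : ℝ≥0∞) * B = ∑ S ∈ 𝒮, ∑ i ∈ Sᶜ, B := by
          have : ∀ S ∈ 𝒮, ∑ i ∈ Sᶜ, B = ((p - m : ℕ) : ℝ≥0∞) * B := by
            intro S hS
            rw [Finset.sum_const, Finset.card_compl, (Finset.mem_powersetCard_univ.1 hS),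
              Fintype.card_fin, nsmul_eq_mul]
          rw [Finset.sum_congr rfl this, Finset.sum_const, hcard𝒮, nsmul_eq_mul, hN, ← mul_assoc]
          push_cast
          rfl
      _ ≤ _ := Finset.sum_le_sum fun S _ => Finset.sum_le_sum fun i hi =>
          (hB i).trans (lintegral_min_le_weighted_error hσ (Finset.mem_compl.1 hi) η _ _)
  have hup : ∑ S ∈ 𝒮, ∑ i ∈ Sᶜ,
      (((p - m : ℕ) : ℝ≥0∞) * P0 S i + ((m + 1 : ℕ) : ℝ≥0∞) * P1 (insert i S) i) ≤
      (N : ℝ≥0∞) * (2 * R) := by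
    simp only [Finset.sum_add_distrib, ← Finset.mul_sum]
    have h0 : ∑ S ∈ 𝒮, ∑ i ∈ Sᶜ, P0 S i ≤ (p.choose m : ℝ≥0∞) * R := by
      rw [← hcard𝒮, ← nsmul_eq_mul]
      refine Finset.sum_le_card_nsmul _ _ _ fun S hS => hr0 S ?_
      rw [Finset.mem_powersetCard_univ.1 hS]
      omega
    have h1 : ∑ T ∈ 𝒯, ∑ i ∈ T, P1 T i ≤ (p.choose (m + 1) : ℝ≥0∞) * R := by
      rw [← hcard𝒯, ← nsmul_eq_mul]
      refine Finset.sum_le_card_nsmul _ _ _ fun T hT => hr1 T ?_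
      rwa [Finset.mem_powersetCard_univ.1 hT]
    calc _ ≤ ((p - m : ℕ) : ℝ≥0∞) * ((p.choose m : ℝ≥0∞) * R) +
          ((m + 1 : ℕ) : ℝ≥0∞) * ((p.choose (m + 1) : ℝ≥0∞) * R) := by
          rw [hpair]
          gcongr
      _ = ((p.choose m * (p - m) : ℕ) : ℝ≥0∞) * R +
          ((p.choose (m + 1) * (m + 1) : ℕ) : ℝ≥0∞) * R := by
          rw [Nat.cast_mul, Nat.cast_mul]
          ring
      _ = (N : ℝ≥0∞) * (2 * R) := by
          rw [← hN', ← hN]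
          ring
  exact (ENNReal.mul_le_mul_iff_right (by exact_mod_cast hNpos.ne')
    (ENNReal.natCast_ne_top N)).1 (hlow.trans hup)

/-! ### Choice of the support size and conclusion. -/

lemma quarter_le_minimaxHammingRisk {n p s m : ℕ} {a σ ε : ℝ} (ha : 0 < a) (hσ : 0 < σ)
    (haσ : a < Real.sqrt 2 * σ) (hε0 : 0 < ε) (hε : ε < 1) (hms : m + 1 ≤ s) (hmp : m + 1 ≤ p - m)
    (hL1 : 250 ≤ Real.log (p - m : ℕ)) (hL2 : 2400000 ≤ ε ^ 2 * Real.log (p - m : ℕ))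
    (hn : (n : ℝ) * (4 * Real.log (1 + a ^ 2 / (4 * σ ^ 2))) ≤
      (1 - ε) * (Real.log (p - m : ℕ) + 7 * Real.log (m + 1 : ℕ))) :
    ENNReal.ofReal (1 / 4) ≤ minimaxHammingRisk n p s a σ := by
  refine le_iInf fun η => ?_
  have hw0 : (0 : ℝ) < (p - m : ℕ) := by
    have : 0 < p - m := by omega
    exact_mod_cast this
  have hw1 : (0 : ℝ) < (m + 1 : ℕ) := by positivity
  have hv : (a / σ) ^ 2 < 2 := by
    have h : a / σ < Real.sqrt 2 := by rwa [div_lt_iff₀ hσ]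
    calc (a / σ) ^ 2 < Real.sqrt 2 ^ 2 := by gcongr
      _ = 2 := Real.sq_sqrt (by norm_num)
  have key : ENNReal.ofReal (1 / 2) ≤ 2 * maxHammingRisk s a σ η := by
    refine le_two_mul_maxHammingRisk ha hσ hms (by omega) η fun i => ?_
    have hΛ := measurable_logLikelihood (n := n) (a / σ) i
    have h := one_half_le_integral_min (μ := (gaussianDesign n p).prod (gaussianNoise n))
      (n := n) hΛ (Nat.cast_nonneg n) (by positivity : 0 < (a / σ) ^ 2) hv
      (fun t ht => mgf_logLikelihood (a / σ) t i ht) hε0 hε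
      (Real.log_nonneg (by push_cast; linarith [Nat.cast_nonneg (α := ℝ) m]))
      (Real.log_le_log hw1 (by exact_mod_cast hmp)) hL1 hL2
      (by rwa [div_pow, div_div, mul_comm (σ ^ 2)])
    refine (ENNReal.ofReal_le_ofReal h).trans_eq ?_
    rw [ofReal_integral_eq_lintegral_ofReal (integrable_min_exp _ hΛ _ _)
      (ae_of_all _ fun z => by positivity)]
    refine lintegral_congr fun z => ?_
    rw [ENNReal.ofReal_min, Real.exp_add, Real.exp_log hw0, Real.exp_log hw1,
      ENNReal.ofReal_mul hw1.le, ENNReal.ofReal_natCast, ENNReal.ofReal_natCast]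
  have h2 : ENNReal.ofReal (1 / 2) = 2 * ENNReal.ofReal (1 / 4) := by
    rw [← ENNReal.ofReal_ofNat 2, ← ENNReal.ofReal_mul (by norm_num)]
    norm_num
  rw [h2] at key
  exact (ENNReal.mul_le_mul_iff_right (by norm_num) (by norm_num)).1 key

/-- Support sizes `m`, `m + 1` for which the testing problem is hardest. -/
lemma exists_support_size {p s : ℕ} {ε : ℝ} (hε0 : 0 < ε) (hε : ε < 1) (hs : 6 ≤ s) (hsp : s < p)
    (hp : 32 / ε ≤ Real.log ((p : ℝ) / 2)) :
    ∃ m : ℕ, m + 1 ≤ s ∧ m + 1 ≤ p - m ∧ (p : ℝ) / 2 ≤ (p - m : ℕ) ∧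
      (1 - ε) * (Real.log ((p : ℝ) - s) + 7 * Real.log s) ≤
        (1 - ε / 2) * (Real.log (p - m : ℕ) + 7 * Real.log (m + 1 : ℕ)) := by
  have hs1 : (1 : ℝ) ≤ s := by exact_mod_cast (by omega : 1 ≤ s)
  have hps : (1 : ℝ) ≤ (p : ℝ) - s := by
    have : ((s + 1 : ℕ) : ℝ) ≤ p := by exact_mod_cast hsp
    push_cast at this
    linarith
  have hp0 : (0 : ℝ) < p := by linarith
  rcases le_or_gt (2 * s) p with h | h
  · have hsub : ((p - (s - 1) : ℕ) : ℝ) = (p : ℝ) - s + 1 := by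
      rw [Nat.cast_sub (by omega), Nat.cast_sub (by omega)]
      push_cast
      ring
    have h' : 2 * (s : ℝ) ≤ p := by exact_mod_cast h
    -- The largest allowed support keeps `m + 1 ≤ p - m`, hence `l ≤ L`, when `2 * s ≤ p`.
    refine ⟨s - 1, by omega, by omega, by rw [hsub]; linarith, ?_⟩
    rw [hsub, Nat.sub_add_cancel (by omega)]
    have h1 := Real.log_le_log (by linarith) (by linarith : (p : ℝ) - s ≤ (p : ℝ) - s + 1)
    have h2 := Real.log_nonneg hps
    have h3 := Real.log_nonneg hs1
    nlinarith
  · have hm : p / 2 - 1 + 1 = p / 2 := by omega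
    have hsub : (p : ℝ) / 2 ≤ (p - (p / 2 - 1) : ℕ) := by
      rw [div_le_iff₀ (by norm_num)]
      exact_mod_cast (by omega : p ≤ (p - (p / 2 - 1)) * 2)
    -- For denser classes, supports of about half the coordinates suffice. Each of the eight
    -- logarithms loses at most `2`, and the total `16` is absorbed by passing from `ε` to `ε / 2`,
    -- as `L ≥ 32 / ε`.
    refine ⟨p / 2 - 1, by omega, by omega, hsub, ?_⟩
    rw [hm]
    have hd0 : (0 : ℝ) < (p / 2 : ℕ) := by exact_mod_cast (by omega : 0 < p / 2)
    have h1 : Real.log ((p : ℝ) - s) ≤ Real.log p := Real.log_le_log (by linarith) (by linarith)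
    have h2 : Real.log s ≤ Real.log p :=
      Real.log_le_log (by linarith) (by exact_mod_cast hsp.le)
    have h3 : Real.log p ≤ 2 + Real.log (p / 2 : ℕ) := by
      have h4 : (p : ℝ) ≤ 3 * (p / 2 : ℕ) := by exact_mod_cast (by omega : p ≤ 3 * (p / 2))
      have h5 := Real.log_le_log hp0 h4
      rw [Real.log_mul (by norm_num) hd0.ne'] at h5
      have h6 := Real.log_le_sub_one_of_pos (show (0 : ℝ) < 3 by norm_num)
      linarith
    have h4 : Real.log (p / 2 : ℕ) ≤ Real.log (p - (p / 2 - 1) : ℕ) :=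
      Real.log_le_log hd0 (by exact_mod_cast (by omega : p / 2 ≤ p - (p / 2 - 1)))
    have h5 := hp.trans (Real.log_le_log (by positivity) hsub)
    rw [div_le_iff₀ hε0] at h5
    have h6 : 0 ≤ Real.log (p / 2 : ℕ) :=
      Real.log_nonneg (by exact_mod_cast (by omega : 1 ≤ p / 2))
    have h7 : Real.log ((p : ℝ) - s) + 7 * Real.log s ≤
        Real.log (p - (p / 2 - 1) : ℕ) + 7 * Real.log (p / 2 : ℕ) + 16 := by linarith
    have h8 := mul_le_mul_of_nonneg_left h7 (by linarith : 0 ≤ 1 - ε)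
    nlinarith [mul_nonneg hε0.le h6]

end SupportRecovery

theorem mainTheorem9 (n s : ℕ → ℕ) (a σ : ℕ → ℝ) (ε : ℝ) (hε₀ : 0 < ε) (hε₁ : ε < 1)
    (hs : ∀ᶠ p : ℕ in atTop, 6 ≤ s p ∧ s p < p)
    (ha : ∀ᶠ p : ℕ in atTop, 0 < a p)
    (hσ : ∀ᶠ p : ℕ in atTop, 0 < σ p)
    (haσ : ∀ᶠ p : ℕ in atTop, a p < Real.sqrt 2 * σ p)
    (hn : ∀ᶠ p : ℕ in atTop,
      (n p : ℝ) < (1 - ε) * ((Real.log ((p : ℝ) - (s p : ℝ)) + 7 * Real.log (s p : ℝ)) /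
        (4 * Real.log (1 + a p ^ 2 / (4 * σ p ^ 2))))) :
    (∃ c : ℝ, 0 < c ∧
      ENNReal.ofReal c ≤
        liminf (fun p : ℕ =>
          SupportRecovery.minimaxHammingRisk (n p) p (s p) (a p) (σ p)) atTop) ∧
    (∀ η : (p : ℕ) → SupportRecovery.Selector (n p) p,
      ¬ Tendsto (fun p : ℕ => SupportRecovery.maxHammingRisk (s p) (a p) (σ p) (η p))
        atTop (𝓝 0)) := by
  have hlim : Tendsto (fun p : ℕ => Real.log ((p : ℝ) / 2)) atTop atTop :=
    Real.tendsto_log_atTop.comp (tendsto_natCast_atTop_atTop.atTop_div_const (by norm_num))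
  have hev : ∀ᶠ p : ℕ in atTop, ENNReal.ofReal (1 / 4) ≤
      SupportRecovery.minimaxHammingRisk (n p) p (s p) (a p) (σ p) := by
    filter_upwards [hs, ha, hσ, haσ, hn, hlim.eventually_ge_atTop 250,
      hlim.eventually_ge_atTop (2400000 / (ε / 2) ^ 2), hlim.eventually_ge_atTop (32 / ε)]
      with p hs ha hσ haσ hn h1 h2 h3
    obtain ⟨m, hms, hmp, hpm, hle⟩ :=
      SupportRecovery.exists_support_size hε₀ hε₁ hs.1 hs.2 h3
    have hp : (0 : ℝ) < (p : ℝ) / 2 := by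
      have : (0 : ℝ) < p := by exact_mod_cast (by omega : 0 < p)
      positivity
    have hlog := Real.log_le_log hp hpm
    have hpos : 0 < 4 * Real.log (1 + a p ^ 2 / (4 * σ p ^ 2)) :=
      mul_pos (by norm_num) (Real.log_pos (lt_add_of_pos_right 1 (by positivity)))
    refine SupportRecovery.quarter_le_minimaxHammingRisk (ε := ε / 2) ha hσ haσ (by positivity)
      (by linarith) hms hmp (h1.trans hlog) ?_ (le_trans ?_ hle)
    · have := h2.trans hlog
      rwa [div_le_iff₀' (by positivity)] at this
    · rw [← mul_div_assoc, lt_div_iff₀ hpos] at hn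
      exact hn.le
  have hlow := le_liminf_of_le (by isBoundedDefault) hev
  refine ⟨⟨1 / 4, by norm_num, hlow⟩, fun η hη => ?_⟩
  have hbound : ENNReal.ofReal (1 / 4) ≤ 0 :=
    ge_of_tendsto hη (hev.mono fun p hp => hp.trans (iInf_le _ (η p)))
  simp at hbound
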